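/- Let $k$ be a number field with ring of integers $R$, let $a,b\in R$ be nonzero, and let $A=\left(\frac{a,b}{k}\right)$ be the quaternion algebra over $k$ with basis $1,i,j,ij$ and relations $i^2=a$, $j^2=b$, $ij=-ji$. Let $\Delta(A)\subseteq R$ be the product of the (finitely many) nonzero prime ideals $\mathfrak p$ of $R$ at which $A$ is ramified, i.e. for which $A\otimes_k k_{\mathfrak p}$ is a division algebra. An order of $A$ is a subring of $A$ (with $1$) containing $R$ that is finitely generated as an $R$-module and spans $A$ over $k$; it is maximal if it is maximal among orders with respect to inclusion. For $e_1,\dots,e_4\in A$ write $R[e_1,\dots,e_4]$ for the $R$-submodule of $A$ generated by $e_1,\dots,e_4$, and put $\mathcal O'=R[1,i,j,ij]$. Suppose that $aR+bR=R$, that $\Delta(A)=abR$, and that one of the following holds: (1) there are $\tilde a,\tilde b\in R$ with $\tilde a^2\equiv a \pmod{4R}$ and $\tilde b^2\equiv b\pmod{4R}$; or (2) $b=-1$ and there is $\tilde a\in R$ with $\tilde a^2\equiv a\pmod{4R}$. Then there are $x_0,x_1\in R$ such that, for $\beta=\tfrac12(x_0+x_1i+j)\in\tfrac12\mathcal O'$,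 the elements $1,i,\beta,i\beta$ are linearly independent over $R$ and $\mathcal O=R[1,i,\beta,i\beta]$ is a maximal order of $A$ containing $\mathcal O'$. -/

import Mathlib

open scoped NumberField Quaternion TensorProduct
open IsDedekindDomain

/-- An `R`-order in a `k`-algebra `A` (with `R` the ring of integers of `k`): a subring with `1`
containing `R` that is a complete `R`-lattice, i.e. finitely generated over `R` and spanning `A`
over `k`. -/
def IsROrder {k : Type*} [Field k] {A : Type*} [Ring A] [Algebra k A]
    [Algebra (𝓞 k) A] [IsScalarTower (𝓞 k) k A] (O : Subalgebra (𝓞 k) A) : Prop :=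
  (Subalgebra.toSubmodule O).FG ∧ Submodule.span k (O : Set A) = ⊤

/-- A maximal order: an order not properly contained in another order. -/
def IsMaximalROrder {k : Type*} [Field k] {A : Type*} [Ring A] [Algebra k A]
    [Algebra (𝓞 k) A] [IsScalarTower (𝓞 k) k A] (O : Subalgebra (𝓞 k) A) : Prop :=
  Maximal (fun O' : Subalgebra (𝓞 k) A => IsROrder O') O

/-- A quaternion algebra `A` over `k` is ramified at the finite prime `v` if `k_v ⊗ A` is a
division algebra, where `k_v` is the completion of `k` at `v`. -/
def IsRamifiedAt (k : Type*) [Field k] [NumberField k] (A : Type*) [Ring A] [Algebra k A]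
    (v : HeightOneSpectrum (𝓞 k)) : Prop :=
  ∀ x : v.adicCompletion k ⊗[k] A, x ≠ 0 → IsUnit x

/-- The set of finite primes at which `A` is ramified. -/
def finiteRamification (k : Type*) [Field k] [NumberField k] (A : Type*) [Ring A] [Algebra k A] :
    Set (HeightOneSpectrum (𝓞 k)) :=
  {v | IsRamifiedAt k A v}

/-- The discriminant `Δ(A)`: the product of the prime ideals at which `A` is ramified. -/
noncomputable def quatDiscriminant (k : Type*) [Field k] [NumberField k]
    (A : Type*) [Ring A] [Algebra k A] : Ideal (𝓞 k) :=
  ∏ᶠ v ∈ finiteRamification k A, v.asIdeal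

/-- The standard generator `i` of the quaternion algebra with Hilbert symbol `(a, b / k)`. -/
def quatI {k : Type*} [Field k] (a b : k) : ℍ[k, a, b] := ⟨0, 1, 0, 0⟩

/-- The standard generator `j` of the quaternion algebra with Hilbert symbol `(a, b / k)`. -/
def quatJ {k : Type*} [Field k] (a b : k) : ℍ[k, a, b] := ⟨0, 0, 1, 0⟩

/-- The defining relations `i² = a`, `j² = b`, `ij = -ji` hold. -/
theorem quat_relations {k : Type*} [Field k] (a b : k) :
    quatI a b * quatI a b = algebraMap k _ a ∧ quatJ a b * quatJ a b = algebraMap k _ b ∧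
      quatI a b * quatJ a b = -(quatJ a b * quatI a b) := by
  refine ⟨?_, ?_, ?_⟩ <;> ext <;> simp [quatI, quatJ, QuaternionAlgebra.algebraMap_eq]

/-- The `R`-module `R[1, i, j, ij]` spanned by the standard basis. -/
def standardOrder {k : Type*} [Field k] (a b : k) : Submodule (𝓞 k) ℍ[k, a, b] :=
  Submodule.span (𝓞 k) {1, quatI a b, quatJ a b, quatI a b * quatJ a b}

/-! If `x₀² - a x₁² - b = 4n`, then `β` has trace `x₀` and norm `n`, so `R[1, i, β, iβ]` is a ring;
the congruences modulo 4 provide such `x₀, x₁`. For maximality, let `x` lie in a larger order. Its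
products with the basis have integral traces, whence `abx ∈ O` (`smul_mem_quatHalfModule_of_trace`).
If `x ∉ O`, a prime `v ∣ ab` contains every `r` with `rx ∈ O`. Since `Δ(A) = abR`, the algebra is
ramified at `v`, and `v` divides exactly one of `a, b`, to the first power; the congruences force `v
∤ 2`. By Hensel the other one is a nonsquare modulo `v`, so the integral norm of `x` forces `rx ∈
R[1, i, j, ij]` for some `r ∉ v` (`exists_denominator_notMem`), a contradiction. -/

/-! ### Hensel lifting of square roots -/

theorem Ideal.exists_sq_sub_mem_pow_succ {R : Type*} [CommRing R] {p : Ideal R} [p.IsMaximal]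
    {b : R} (hb : b ∉ p) (h2 : (2 : R) ∉ p) (n : ℕ) (r : R) (hr : r ^ 2 - b ∈ p ^ (n + 1)) :
    ∃ s : R, s ^ 2 - b ∈ p ^ (n + 2) ∧ s - r ∈ p ^ (n + 1) := by
  have hp : p.IsPrime := Ideal.IsMaximal.isPrime inferInstance
  have hrp : r ^ 2 - b ∈ p := Ideal.pow_le_self (Nat.succ_ne_zero n) hr
  have hr0 : r ∉ p := fun h => hb <| by
    have := p.sub_mem (p.mul_mem_left r h) hrp
    convert this using 1; ring
  have h2r : 2 * r ∉ p := fun h => (hp.mem_or_mem h).elim h2 hr0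
  obtain ⟨t, ht⟩ := Ideal.IsMaximal.exists_inv inferInstance h2r
  obtain ⟨u, hu, htu⟩ := ht
  -- Newton step for `X² - b`, with `t` an inverse of the derivative `2r` modulo `p`.
  refine ⟨r - t * (r ^ 2 - b), ?_, ?_⟩
  · have h1 : (r ^ 2 - b) * u ∈ p ^ (n + 2) := by
      rw [pow_succ p (n + 1)]; exact Ideal.mul_mem_mul hr hu
    have h3 : (r ^ 2 - b) * (r ^ 2 - b) ∈ p ^ (n + 2) := by
      rw [pow_succ p (n + 1)]; exact Ideal.mul_mem_mul hr hrp
    convert (p ^ (n + 2)).add_mem h1 ((p ^ (n + 2)).mul_mem_left (t ^ 2) h3) using 1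
    linear_combination (-(r ^ 2 - b)) * htu
  · convert (p ^ (n + 1)).mul_mem_left (-t) hr using 1
    ring

theorem Ideal.exists_seq_sq_sub_mem_pow {R : Type*} [CommRing R] {p : Ideal R} [p.IsMaximal]
    {b r : R} (hb : b ∉ p) (h2 : (2 : R) ∉ p) (hr : r ^ 2 - b ∈ p) :
    ∃ s : ℕ → R, ∀ n, s n ^ 2 - b ∈ p ^ (n + 1) ∧ s (n + 1) - s n ∈ p ^ (n + 1) := by
  choose! f hf hf' using Ideal.exists_sq_sub_mem_pow_succ (p := p) hb h2
  let s : ℕ → R := fun n => Nat.rec r (fun n x => f n x) n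
  have hs : ∀ n, s n ^ 2 - b ∈ p ^ (n + 1) := by
    intro n
    induction n with
    | zero => simpa [s] using hr
    | succ n ih => exact hf n _ ih
  exact ⟨s, fun n => ⟨hs n, hf' n _ (hs n)⟩⟩

open Filter Topology in
/-- A `v`-adic unit that is a square modulo `v ∤ 2` is a square in the completion at `v`. -/
theorem IsDedekindDomain.HeightOneSpectrum.exists_sq_eq_adicCompletion {R K : Type*} [CommRing R]
    [IsDedekindDomain R] [Field K] [Algebra R K] [IsFractionRing R K] (v : HeightOneSpectrum R)
    {b r : R} (hb : b ∉ v.asIdeal) (h2 : (2 : R) ∉ v.asIdeal) (hr : r ^ 2 - b ∈ v.asIdeal) :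
    ∃ s : v.adicCompletion K, s ^ 2 = algebraMap R (v.adicCompletion K) b := by
  have : v.asIdeal.IsMaximal := v.isMaximal
  obtain ⟨s, hs⟩ := Ideal.exists_seq_sq_sub_mem_pow hb h2 hr
  have hval : ∀ (x : R) (n : ℕ), x ∈ v.asIdeal ^ n →
      Valued.v (algebraMap R (v.adicCompletion K) x) ≤ WithZero.exp (-(n : ℤ)) := by
    intro x n hx
    rw [show algebraMap R (v.adicCompletion K) x = ((algebraMap R K x : K) : v.adicCompletion K)
      from rfl, v.valuedAdicCompletion_eq_valuation', v.valuation_of_algebraMap]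
    exact (v.intValuation_le_pow_iff_mem x n).2 hx
  have hlt : ∀ γ : (MonoidWithZeroHom.ValueGroup₀
      (.ofClass (Valued.v : Valuation (v.adicCompletion K) (WithZero (Multiplicative ℤ)))))ˣ,
      ∃ n : ℕ, ∀ x : R, x ∈ v.asIdeal ^ (n + 1) →
        Valued.v.restrict (algebraMap R (v.adicCompletion K) x) < γ.1 := by
    intro γ
    have hγ : MonoidWithZeroHom.ValueGroup₀.embedding γ.1 ≠ 0 := by simp
    refine ⟨(WithZero.log (MonoidWithZeroHom.ValueGroup₀.embedding γ.1)).natAbs, fun x hx => ?_⟩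
    rw [Valuation.restrict_lt_iff_lt_embedding]
    refine (hval x _ hx).trans_lt ?_
    rw [← WithZero.lt_log_iff_exp_lt hγ]
    omega
  have hdiff : ∀ n k, s (n + k) - s n ∈ v.asIdeal ^ (n + 1) := by
    intro n k
    induction k with
    | zero => simp
    | succ k ih =>
      have := Ideal.pow_le_pow_right (I := v.asIdeal) (show n + 1 ≤ n + k + 1 by omega)
        (hs (n + k)).2
      simpa [add_assoc] using (v.asIdeal ^ (n + 1)).add_mem this ih
  have hdiff' : ∀ n i j, n ≤ i → n ≤ j → s j - s i ∈ v.asIdeal ^ (n + 1) := by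
    intro n i j hi hj
    obtain ⟨i, rfl⟩ := Nat.exists_eq_add_of_le hi
    obtain ⟨j, rfl⟩ := Nat.exists_eq_add_of_le hj
    simpa using (v.asIdeal ^ (n + 1)).sub_mem (hdiff n j) (hdiff n i)
  let t : ℕ → v.adicCompletion K := fun n => algebraMap R (v.adicCompletion K) (s n)
  have hC : CauchySeq t := by
    refine (Valued.cauchy_iff).2 ⟨inferInstance, fun γ => ?_⟩
    obtain ⟨n, hn⟩ := hlt γ
    refine ⟨t '' Set.Ici n, image_mem_map (Ici_mem_atTop n), ?_⟩
    rintro _ ⟨i, hi, rfl⟩ _ ⟨j, hj, rfl⟩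
    rw [← map_sub]
    exact hn _ (hdiff' n i j hi hj)
  obtain ⟨l, hl⟩ := cauchySeq_tendsto_of_complete hC
  refine ⟨l, tendsto_nhds_unique (hl.pow 2) fun U hU => ?_⟩
  obtain ⟨γ, hγ⟩ := Valued.mem_nhds.1 hU
  obtain ⟨n, hn⟩ := hlt γ
  refine mem_map.2 (mem_of_superset (Ici_mem_atTop n) fun m hm => hγ ?_)
  change Valued.v.restrict (t m ^ 2 - _) < γ.1
  rw [← map_pow, ← map_sub]
  exact hn _ (Ideal.pow_le_pow_right (Nat.succ_le_succ hm) (hs m).1)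

/-! ### Integrality of trace and norm -/

open Polynomial in
/-- The reduced trace and the reduced norm of an integral quaternion are integral. -/
theorem QuaternionAlgebra.exists_trace_norm_of_isIntegral {R k : Type*} [CommRing R] [IsDomain R]
    [IsIntegrallyClosed R] [Field k] [Algebra R k] [IsFractionRing R k] {a b : k}
    {x : ℍ[k, a, b]} (hx : IsIntegral R x) :
    (∃ t : R, algebraMap R k t = 2 * x.re) ∧
      ∃ n : R, algebraMap R k n =
        x.re ^ 2 - a * x.imI ^ 2 - b * x.imJ ^ 2 + a * b * x.imK ^ 2 := by
  by_cases hxk : x ∈ (algebraMap k ℍ[k, a, b]).range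
  · obtain ⟨c, rfl⟩ := hxk
    have hc : IsIntegral R c :=
      (isIntegral_algebraMap_iff (algebraMap k ℍ[k, a, b]).injective).1 hx
    obtain ⟨c, rfl⟩ := IsIntegrallyClosed.isIntegral_iff.1 hc
    exact ⟨⟨2 * c, by simp [QuaternionAlgebra.algebraMap_eq, map_ofNat]⟩,
      ⟨c ^ 2, by simp [QuaternionAlgebra.algebraMap_eq]⟩⟩
  -- For nonscalar `x` the reduced characteristic polynomial `q` is the minimal polynomial, which
  -- has coefficients in `R` as `R` is integrally closed.
  · set n : k := x.re ^ 2 - a * x.imI ^ 2 - b * x.imJ ^ 2 + a * b * x.imK ^ 2 with hn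
    let q : k[X] := X ^ 2 - C (2 * x.re) * X + C n
    have hq : q = X ^ 2 + (- C (2 * x.re) * X + C n) := by simp only [q]; ring
    have hdeg : q.natDegree = 2 := by simp only [q]; compute_degree!
    have hqm : q.Monic := by
      rw [hq]; exact monic_X_pow_add (by compute_degree!)
    have hq0 : aeval x q = 0 := by
      simp only [q, map_add, map_sub, map_mul, map_pow, aeval_X, aeval_C,
        QuaternionAlgebra.algebraMap_eq]
      ext <;> simp [pow_two, hn] <;> ring
    have hint : IsIntegral k x := hx.tower_top
    have hmin : minpoly k x = q :=
      (eq_of_monic_of_dvd_of_natDegree_le (minpoly.monic hint) hqm (minpoly.dvd k x hq0) (by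
        rw [hdeg]; exact (minpoly.two_le_natDegree_iff hint).2 hxk)).symm
    obtain ⟨p, hp, hpx⟩ := hx
    have hdvd : minpoly k x ∣ p.map (algebraMap R k) := by
      refine minpoly.dvd k x ?_
      rw [aeval_map_algebraMap]; exact hpx
    obtain ⟨g, hg⟩ := IsIntegrallyClosed.eq_map_mul_C_of_dvd k hp hdvd
    rw [(minpoly.monic hint).leadingCoeff, C_1, mul_one, hmin] at hg
    refine ⟨⟨-g.coeff 1, ?_⟩, ⟨g.coeff 0, ?_⟩⟩
    · rw [map_neg, ← coeff_map, hg]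
      simp [q, coeff_C]
    · rw [← coeff_map, hg]
      simp [q]

/-! ### Ramification and local denominators -/

/-- If a noncentral `x` squares to a scalar that is a square in `k_v`, then `A` is unramified
at `v`. -/
theorem not_isRamifiedAt_of_sq_eq {k : Type*} [Field k] [NumberField k] {A : Type*} [Ring A]
    [Nontrivial A] [Algebra k A] (v : HeightOneSpectrum (𝓞 k)) {x y : A} {c : k}
    (hx : x * x = algebraMap k A c) (hxy : x * y ≠ y * x)
    {s : v.adicCompletion k} (hs : s ^ 2 = algebraMap k (v.adicCompletion k) c) :
    ¬ IsRamifiedAt k A v := by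
  intro hram
  have hinj : Function.Injective
      (Algebra.TensorProduct.includeRight : A →ₐ[k] v.adicCompletion k ⊗[k] A) :=
    Algebra.TensorProduct.includeRight_injective (algebraMap k (v.adicCompletion k)).injective
  -- Elements `t ⊗ 1` commute with `1 ⊗ y`, but `1 ⊗ x` does not. Hence `x - s` and `x + s` are zero
  -- divisors.
  have hne : ∀ t : v.adicCompletion k, (1 : v.adicCompletion k) ⊗ₜ[k] x - t ⊗ₜ[k] (1 : A) ≠ 0 := by
    intro t ht
    refine hxy (hinj ?_)
    rw [map_mul, map_mul]
    simp only [Algebra.TensorProduct.includeRight_apply]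
    rw [sub_eq_zero.1 ht]
    simp
  have hmul : ((1 : v.adicCompletion k) ⊗ₜ[k] x - s ⊗ₜ[k] (1 : A)) *
      ((1 : v.adicCompletion k) ⊗ₜ[k] x - (-s) ⊗ₜ[k] (1 : A)) = 0 := by
    simp only [sub_mul, mul_sub, Algebra.TensorProduct.tmul_mul_tmul, one_mul, mul_one, hx,
      TensorProduct.neg_tmul, mul_neg, ← pow_two s, hs]
    rw [Algebra.algebraMap_eq_smul_one, Algebra.algebraMap_eq_smul_one, TensorProduct.tmul_smul,
      TensorProduct.smul_tmul']
    abel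
  exact hne _ (((hram _ (hne s)).mul_right_eq_zero).1 hmul)

theorem IsDedekindDomain.HeightOneSpectrum.of_mem_finprod_asIdeal {R : Type*} [CommRing R]
    [IsDedekindDomain R] {S : Set (HeightOneSpectrum R)} {c : R}
    (h : ∏ᶠ v ∈ S, v.asIdeal = Ideal.span {c}) (v : HeightOneSpectrum R) (hv : c ∈ v.asIdeal) :
    v ∈ S ∧ c ∉ v.asIdeal ^ 2 := by
  have hle : ∏ᶠ w ∈ S, w.asIdeal ≤ v.asIdeal := by
    rw [h, Ideal.span_singleton_le_iff_mem]; exact hv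
  by_cases hfin : S.Finite
  · rw [finprod_mem_eq_finite_toFinset_prod _ hfin] at h hle
    obtain ⟨w, hw, hwv⟩ := (Ideal.IsPrime.prod_le v.isPrime).1 hle
    have hwv' : w = v := HeightOneSpectrum.ext
      (w.isMaximal.eq_of_le v.isPrime.ne_top hwv)
    subst hwv'
    refine ⟨by simpa using hw, fun hc => ?_⟩
    classical
    rw [← Finset.mul_prod_erase _ _ hw] at h
    rw [← Ideal.span_singleton_le_iff_mem, ← h, pow_two, ← Ideal.dvd_iff_le] at hc
    have h1 := Ideal.le_of_dvd ((mul_dvd_mul_iff_left w.ne_bot).1 hc)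
    obtain ⟨u, hu, huw⟩ := (Ideal.IsPrime.prod_le w.isPrime).1 h1
    exact (Finset.mem_erase.1 hu).1 (HeightOneSpectrum.ext
      (u.isMaximal.eq_of_le w.isPrime.ne_top huw))
  -- An infinite `finprod` defaults to the unit ideal, which lies in no prime.
  · rw [finprod_mem_eq_one_of_infinite, Ideal.one_eq_top, top_le_iff] at hle
    · exact absurd hle v.isPrime.ne_top
    · convert hfin
      refine Set.inter_eq_left.2 fun w _ => ?_
      exact fun h => w.isPrime.ne_top (by simpa using h)

/-- Write `(a) = vJ`; then `J ⊄ v`, and any `s ∈ J` outside `v` works. -/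
theorem IsDedekindDomain.HeightOneSpectrum.exists_notMem_mul_mem_span {R : Type*} [CommRing R]
    [IsDedekindDomain R] (v : HeightOneSpectrum R) {a : R} (ha : a ∈ v.asIdeal)
    (ha2 : a ∉ v.asIdeal ^ 2) : ∃ s ∉ v.asIdeal, ∀ c ∈ v.asIdeal, a ∣ s * c := by
  obtain ⟨J, hJ⟩ := Ideal.dvd_span_singleton.2 ha
  have hJv : ¬ J ≤ v.asIdeal := by
    intro h
    refine ha2 ?_
    rw [← Ideal.span_singleton_le_iff_mem, hJ, pow_two]
    exact Ideal.mul_mono_right h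
  obtain ⟨s, hs, hsv⟩ := Set.not_subset.1 hJv
  refine ⟨s, hsv, fun c hc => ?_⟩
  rw [← Ideal.mem_span_singleton, hJ, mul_comm s]
  exact Ideal.mul_mem_mul hc hs

/-- A quaternion with integral norm whose pairings with `1, i, j, ij` are `C₀, C₁, C₂, C₃` lies in
the standard order locally at `v`, if `v` divides `a` exactly, and `b` is no square modulo `v`. -/
theorem exists_denominator_notMem {R : Type*} [CommRing R] [IsDedekindDomain R]
    (v : HeightOneSpectrum R) {a b C₀ C₁ C₂ C₃ n : R} (h2 : (2 : R) ∉ v.asIdeal)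
    (ha : a ∈ v.asIdeal) (ha2 : a ∉ v.asIdeal ^ 2) (hb : b ∉ v.asIdeal)
    (hsq : ∀ r : R, r ^ 2 - b ∉ v.asIdeal)
    (hn : 4 * a * b * n = a * b * C₀ ^ 2 - b * C₁ ^ 2 - a * C₂ ^ 2 + C₃ ^ 2) :
    ∃ r ∉ v.asIdeal, ∃ m₀ m₁ m₂ m₃ : R, r * C₀ = 2 * m₀ ∧ r * C₁ = 2 * a * m₁ ∧
      r * C₂ = 2 * b * m₂ ∧ r * C₃ = 2 * a * b * m₃ := by
  have hp := v.isPrime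
  have h0 : C₃ ^ 2 - b * C₁ ^ 2 ∈ v.asIdeal := by
    convert v.asIdeal.mul_mem_right (4 * b * n - b * C₀ ^ 2 + C₂ ^ 2) ha using 1
    linear_combination -hn
  have h1 : C₁ ∈ v.asIdeal := by
    by_contra h1
    -- If `C₁` were invertible modulo `v`, then `C₃ / C₁` would be a square root of `b` there.
    obtain ⟨u, w, hw, huw⟩ := v.isMaximal.exists_inv h1
    refine hsq (u * C₃) ?_
    convert v.asIdeal.add_mem (v.asIdeal.mul_mem_left (u ^ 2) h0)
      (v.asIdeal.mul_mem_left (- b * (u * C₁ + 1)) hw) using 1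
    linear_combination b * (u * C₁ + 1) * huw
  have h3 : C₃ ∈ v.asIdeal := by
    refine hp.mem_of_pow_mem 2 ?_
    convert v.asIdeal.add_mem h0 (v.asIdeal.mul_mem_left (b * C₁) h1) using 1
    ring
  obtain ⟨s, hs, hsc⟩ := v.exists_notMem_mul_mem_span ha ha2
  obtain ⟨m₁, hm₁⟩ := hsc _ h1
  obtain ⟨m₃, hm₃⟩ := hsc _ h3
  refine ⟨2 * s * b, fun h => ?_, s * b * C₀, b * m₁, s * C₂, m₃, by ring,
    by linear_combination 2 * b * hm₁, by ring, by linear_combination 2 * b * hm₃⟩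
  exact (hp.mem_or_mem h).elim (fun h => (hp.mem_or_mem h).elim h2 hs) hb

/-! ### The order `R[1, i, β, iβ]` -/

section HalfOrder

variable {k : Type*} [Field k]

/-- The element `(x₀ + x₁ i + j) / 2`. -/
noncomputable def quatHalf (a b x₀ x₁ : 𝓞 k) : ℍ[k, (a : k), (b : k)] :=
  (1 / 2 : k) • (x₀ • 1 + x₁ • quatI (a : k) (b : k) + quatJ (a : k) (b : k))

/-- The `R`-module `R[1, i, β, iβ]` for `β = (x₀ + x₁ i + j) / 2`. -/
noncomputable def quatHalfModule (a b x₀ x₁ : 𝓞 k) : Submodule (𝓞 k) ℍ[k, (a : k), (b : k)] :=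
  Submodule.span (𝓞 k) {1, quatI (a : k) (b : k), quatHalf a b x₀ x₁,
    quatI (a : k) (b : k) * quatHalf a b x₀ x₁}

theorem one_mem_quatHalfModule (a b x₀ x₁ : 𝓞 k) :
    (1 : ℍ[k, (a : k), (b : k)]) ∈ quatHalfModule a b x₀ x₁ :=
  Submodule.subset_span (by simp)

theorem mem_standardOrder (a b m₀ m₁ m₂ m₃ : 𝓞 k) :
    (⟨m₀, m₁, m₂, m₃⟩ : ℍ[k, (a : k), (b : k)]) ∈ standardOrder (a : k) (b : k) := by
  simp only [standardOrder, Submodule.mem_span_insert, Submodule.mem_span_singleton]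
  refine ⟨m₀, _, ⟨m₁, _, ⟨m₂, _, ⟨m₃, rfl⟩, rfl⟩, rfl⟩, ?_⟩
  ext <;> simp [quatI, quatJ, Algebra.smul_def]

variable [NumberField k]

theorem quatHalf_combination (a b x₀ x₁ y₀ y₁ y₂ y₃ : 𝓞 k) :
    y₀ • (1 : ℍ[k, (a : k), (b : k)]) + (y₁ • quatI (a : k) (b : k) +
      (y₂ • quatHalf a b x₀ x₁ + y₃ • (quatI (a : k) (b : k) * quatHalf a b x₀ x₁))) =
    ⟨y₀ + (x₀ * y₂ + a * x₁ * y₃) / 2, y₁ + (x₁ * y₂ + x₀ * y₃) / 2, y₂ / 2, y₃ / 2⟩ := by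
  ext <;> simp [quatHalf, quatI, quatJ, Algebra.smul_def] <;> ring

theorem mem_quatHalfModule {a b x₀ x₁ : 𝓞 k} {x : ℍ[k, (a : k), (b : k)]} :
    x ∈ quatHalfModule a b x₀ x₁ ↔ ∃ y₀ y₁ y₂ y₃ : 𝓞 k,
      x = ⟨y₀ + (x₀ * y₂ + a * x₁ * y₃) / 2, y₁ + (x₁ * y₂ + x₀ * y₃) / 2, y₂ / 2, y₃ / 2⟩ := by
  simp only [quatHalfModule, Submodule.mem_span_insert, Submodule.mem_span_singleton]
  constructor
  · rintro ⟨y₀, _, ⟨y₁, _, ⟨y₂, _, ⟨y₃, rfl⟩, rfl⟩, rfl⟩, rfl⟩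
    exact ⟨y₀, y₁, y₂, y₃, quatHalf_combination ..⟩
  · rintro ⟨y₀, y₁, y₂, y₃, rfl⟩
    exact ⟨y₀, _, ⟨y₁, _, ⟨y₂, _, ⟨y₃, rfl⟩, rfl⟩, rfl⟩, (quatHalf_combination ..).symm⟩

theorem linearIndependent_quatHalf (a b x₀ x₁ : 𝓞 k) :
    LinearIndependent (𝓞 k) ![1, quatI (a : k) (b : k), quatHalf a b x₀ x₁,
      quatI (a : k) (b : k) * quatHalf a b x₀ x₁] := by
  rw [Fintype.linearIndependent_iff]
  intro g hg
  simp only [Fin.sum_univ_four, Matrix.cons_val, add_assoc] at hg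
  rw [quatHalf_combination] at hg
  have h0 := congrArg QuaternionAlgebra.re hg
  have h1 := congrArg QuaternionAlgebra.imI hg
  have h2 := congrArg QuaternionAlgebra.imJ hg
  have h3 := congrArg QuaternionAlgebra.imK hg
  simp at h0 h1 h2 h3
  simp [h2, h3] at h0 h1
  intro i
  fin_cases i <;> simp [h0, h1, h2, h3]

theorem mul_mem_quatHalfModule {a b x₀ x₁ n : 𝓞 k} (hn : x₀ ^ 2 - a * x₁ ^ 2 - b = 4 * n)
    {x y : ℍ[k, (a : k), (b : k)]} (hx : x ∈ quatHalfModule a b x₀ x₁)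
    (hy : y ∈ quatHalfModule a b x₀ x₁) : x * y ∈ quatHalfModule a b x₀ x₁ := by
  obtain rfl : b = x₀ ^ 2 - a * x₁ ^ 2 - 4 * n := by linear_combination -hn
  obtain ⟨y₀, y₁, y₂, y₃, rfl⟩ := mem_quatHalfModule.1 hx
  obtain ⟨z₀, z₁, z₂, z₃, rfl⟩ := mem_quatHalfModule.1 hy
  -- Multiplication table from `β² = x₀β - n` and `βi = x₁a + x₀i - iβ`.
  refine mem_quatHalfModule.2 ⟨
    y₀ * z₀ + a * y₁ * z₁ + x₁ * a * y₂ * z₁ - n * y₂ * z₂ + x₀ * a * y₃ * z₁ + a * n * y₃ * z₃,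
    y₀ * z₁ + y₁ * z₀ + x₀ * y₂ * z₁ + n * y₂ * z₃ + x₁ * a * y₃ * z₁ - n * y₃ * z₂,
    y₀ * z₂ + y₂ * z₀ + a * y₁ * z₃ + x₀ * y₂ * z₂ + x₁ * a * y₂ * z₃ - a * y₃ * z₁,
    y₀ * z₃ + y₃ * z₀ + y₁ * z₂ - y₂ * z₁ + x₀ * y₃ * z₂ + x₁ * a * y₃ * z₃, ?_⟩
  have h4 : ((4 : 𝓞 k) : k) = 4 := map_ofNat (algebraMap (𝓞 k) k) 4
  ext <;> simp [h4] <;> ring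

/-- The order `R[1, i, β, iβ]` for `β = (x₀ + x₁ i + j) / 2`. -/
noncomputable def quatHalfOrder (a b x₀ x₁ n : 𝓞 k) (hn : x₀ ^ 2 - a * x₁ ^ 2 - b = 4 * n) :
    Subalgebra (𝓞 k) ℍ[k, (a : k), (b : k)] :=
  (quatHalfModule a b x₀ x₁).toSubalgebra (one_mem_quatHalfModule a b x₀ x₁)
    fun _ _ => mul_mem_quatHalfModule hn

theorem standardOrder_le_quatHalfModule (a b x₀ x₁ : 𝓞 k) :
    standardOrder (a : k) (b : k) ≤ quatHalfModule a b x₀ x₁ := by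
  refine Submodule.span_le.2 ?_
  rintro _ (rfl | rfl | rfl | rfl) <;> rw [SetLike.mem_coe]
  · exact one_mem_quatHalfModule a b x₀ x₁
  · exact Submodule.subset_span (by simp)
  -- `j = 2β - x₀ - x₁i`; multiplying by `i` gives `ij`.
  · refine mem_quatHalfModule.2 ⟨-x₀, -x₁, 2, 0, ?_⟩
    have h2 : ((2 : 𝓞 k) : k) = 2 := map_ofNat (algebraMap (𝓞 k) k) 2
    ext <;> simp [quatJ, h2]
  · refine mem_quatHalfModule.2 ⟨-(a * x₁), -x₀, 0, 2, ?_⟩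
    have h2 : ((2 : 𝓞 k) : k) = 2 := map_ofNat (algebraMap (𝓞 k) k) 2
    ext <;> simp [quatI, quatJ, h2]

theorem two_smul_quatHalf_mem_standardOrder (a b x₀ x₁ : 𝓞 k) :
    (2 : k) • quatHalf a b x₀ x₁ ∈ standardOrder (a : k) (b : k) := by
  rw [quatHalf, smul_smul, mul_one_div_cancel two_ne_zero, one_smul]
  convert mem_standardOrder a b x₀ x₁ 1 0 using 1
  ext <;> simp [quatI, quatJ, Algebra.smul_def]

theorem isROrder_quatHalfOrder {a b x₀ x₁ n : 𝓞 k} (hn : x₀ ^ 2 - a * x₁ ^ 2 - b = 4 * n) :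
    IsROrder (quatHalfOrder a b x₀ x₁ n hn) := by
  refine ⟨Submodule.fg_span (Set.toFinite _), ?_⟩
  rw [eq_top_iff]
  intro x _
  have hmem : ∀ (c : k) (m₀ m₁ m₂ m₃ : 𝓞 k),
      c • (⟨m₀, m₁, m₂, m₃⟩ : ℍ[k, (a : k), (b : k)]) ∈
        Submodule.span k (quatHalfOrder a b x₀ x₁ n hn : Set ℍ[k, (a : k), (b : k)]) :=
    fun c m₀ m₁ m₂ m₃ => Submodule.smul_mem _ _ <| Submodule.subset_span <|
      standardOrder_le_quatHalfModule a b x₀ x₁ (mem_standardOrder a b m₀ m₁ m₂ m₃)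
  have hx : x = x.re • (⟨(1 : 𝓞 k), (0 : 𝓞 k), (0 : 𝓞 k), (0 : 𝓞 k)⟩ : ℍ[k, (a : k), (b : k)]) +
      x.imI • (⟨(0 : 𝓞 k), (1 : 𝓞 k), (0 : 𝓞 k), (0 : 𝓞 k)⟩ : ℍ[k, (a : k), (b : k)]) +
      x.imJ • (⟨(0 : 𝓞 k), (0 : 𝓞 k), (1 : 𝓞 k), (0 : 𝓞 k)⟩ : ℍ[k, (a : k), (b : k)]) +
      x.imK • (⟨(0 : 𝓞 k), (0 : 𝓞 k), (0 : 𝓞 k), (1 : 𝓞 k)⟩ : ℍ[k, (a : k), (b : k)]) := by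
    ext <;> simp
  rw [hx]
  exact add_mem (add_mem (add_mem (hmem _ _ _ _ _) (hmem _ _ _ _ _)) (hmem _ _ _ _ _))
    (hmem _ _ _ _ _)

end HalfOrder

/-! ### Maximality -/

section Maximality

variable {k : Type*} [Field k] [NumberField k]

/-- The `tᵢ` are the traces of `x` times `1, i, β, iβ`. Inverting the Gram matrix of the trace form
costs only the denominator `ab`. -/
theorem smul_mem_quatHalfModule_of_trace {a b x₀ x₁ n : 𝓞 k}
    (hn : x₀ ^ 2 - a * x₁ ^ 2 - b = 4 * n) {x : ℍ[k, (a : k), (b : k)]} {t₀ t₁ t₂ t₃ : 𝓞 k}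
    (h₀ : (t₀ : k) = 2 * x.re) (h₁ : (t₁ : k) = 2 * a * x.imI)
    (h₂ : (t₂ : k) = x₀ * x.re + a * x₁ * x.imI + b * x.imJ)
    (h₃ : (t₃ : k) = a * x₁ * x.re + a * x₀ * x.imI - a * b * x.imK) :
    (a * b) • x ∈ quatHalfModule a b x₀ x₁ := by
  obtain rfl : b = x₀ ^ 2 - a * x₁ ^ 2 - 4 * n := by linear_combination -hn
  have h2 : ((2 : 𝓞 k) : k) = 2 := map_ofNat (algebraMap (𝓞 k) k) 2
  have h4 : ((4 : 𝓞 k) : k) = 4 := map_ofNat (algebraMap (𝓞 k) k) 4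
  refine mem_quatHalfModule.2 ⟨a * (x₀ ^ 2 - a * x₁ ^ 2 - 2 * n) * t₀ - a * x₀ * t₂ + a * x₁ * t₃,
    -2 * n * t₁ - x₁ * a * t₂ + x₀ * t₃, 2 * a * t₂ - a * x₀ * t₀ - a * x₁ * t₁,
    a * x₁ * t₀ + x₀ * t₁ - 2 * t₃, ?_⟩
  ext <;> simp [h2, h4, h₀, h₁, h₂, h₃, Algebra.smul_def] <;> ring

theorem smul_mem_standardOrder_of_mul_eq {a b r C₀ C₁ C₂ C₃ m₀ m₁ m₂ m₃ : 𝓞 k} (ha : a ≠ 0)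
    (hb : b ≠ 0) {x : ℍ[k, (a : k), (b : k)]} (h₀ : (C₀ : k) = 2 * x.re)
    (h₁ : (C₁ : k) = 2 * a * x.imI) (h₂ : (C₂ : k) = 2 * b * x.imJ)
    (h₃ : (C₃ : k) = 2 * a * b * x.imK) (e₀ : r * C₀ = 2 * m₀) (e₁ : r * C₁ = 2 * a * m₁)
    (e₂ : r * C₂ = 2 * b * m₂) (e₃ : r * C₃ = 2 * a * b * m₃) :
    r • x ∈ standardOrder (a : k) (b : k) := by
  have h2 : ((2 : 𝓞 k) : k) = 2 := map_ofNat (algebraMap (𝓞 k) k) 2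
  have ha' : (a : k) ≠ 0 := by simpa using ha
  have hb' : (b : k) ≠ 0 := by simpa using hb
  convert mem_standardOrder a b m₀ m₁ m₂ m₃ using 1
  have e₀ := congrArg (algebraMap (𝓞 k) k) e₀
  have e₁ := congrArg (algebraMap (𝓞 k) k) e₁
  have e₂ := congrArg (algebraMap (𝓞 k) k) e₂
  have e₃ := congrArg (algebraMap (𝓞 k) k) e₃
  simp only [map_mul, map_ofNat, h₀, h₁, h₂, h₃] at e₀ e₁ e₂ e₃
  ext <;> simp only [QuaternionAlgebra.re_smul, QuaternionAlgebra.imI_smul,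
    QuaternionAlgebra.imJ_smul, QuaternionAlgebra.imK_smul, Algebra.smul_def]
  · refine mul_left_cancel₀ (two_ne_zero (α := k)) ?_
    linear_combination e₀
  · refine mul_left_cancel₀ (mul_ne_zero two_ne_zero ha') ?_
    linear_combination e₁
  · refine mul_left_cancel₀ (mul_ne_zero two_ne_zero hb') ?_
    linear_combination e₂
  · refine mul_left_cancel₀ (mul_ne_zero (mul_ne_zero two_ne_zero ha') hb') ?_
    linear_combination e₃

theorem sq_sub_notMem_of_isRamifiedAt {A : Type*} [Ring A] [Nontrivial A] [Algebra k A]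
    {v : HeightOneSpectrum (𝓞 k)} (hram : IsRamifiedAt k A v) {c : 𝓞 k} {x y : A}
    (hx : x * x = algebraMap k A c) (hxy : x * y ≠ y * x) (hc : c ∉ v.asIdeal)
    (h2 : (2 : 𝓞 k) ∉ v.asIdeal) (r : 𝓞 k) : r ^ 2 - c ∉ v.asIdeal := by
  intro hr
  obtain ⟨s, hs⟩ := v.exists_sq_eq_adicCompletion (K := k) hc h2 hr
  exact not_isRamifiedAt_of_sq_eq v hx hxy hs hram

theorem quatI_mul_quatJ_ne (a b : k) :
    quatI a b * quatJ a b ≠ quatJ a b * quatI a b := by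
  intro h
  have := congrArg QuaternionAlgebra.imK h
  simp [quatI, quatJ] at this
  have h2 : (2 : k) = 0 := by linear_combination this
  exact two_ne_zero h2

theorem isMaximalROrder_quatHalfOrder {a b x₀ x₁ n : 𝓞 k} (ha : a ≠ 0) (hb : b ≠ 0)
    (hcop : IsCoprime a b) (hn : x₀ ^ 2 - a * x₁ ^ 2 - b = 4 * n)
    (hram : ∀ v : HeightOneSpectrum (𝓞 k), a * b ∈ v.asIdeal →
      IsRamifiedAt k ℍ[k, (a : k), (b : k)] v ∧ a * b ∉ v.asIdeal ^ 2 ∧ (2 : 𝓞 k) ∉ v.asIdeal) :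
    IsMaximalROrder (quatHalfOrder a b x₀ x₁ n hn) := by
  refine ⟨isROrder_quatHalfOrder hn, fun Λ hΛ hle x hx => ?_⟩
  have hint : ∀ y ∈ Λ, IsIntegral (𝓞 k) y := fun y hy => IsIntegral.of_mem_of_fg Λ hΛ.1 y hy
  have htr : ∀ y ∈ quatHalfModule a b x₀ x₁, ∃ t : 𝓞 k, (t : k) = 2 * (x * y).re := fun y hy =>
    (QuaternionAlgebra.exists_trace_norm_of_isIntegral (hint _ (mul_mem hx (hle hy)))).1
  have hstd := standardOrder_le_quatHalfModule a b x₀ x₁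
  obtain ⟨C₀, h₀⟩ := htr 1 (one_mem_quatHalfModule a b x₀ x₁)
  obtain ⟨C₁, h₁⟩ := htr (quatI (a : k) (b : k)) (Submodule.subset_span (by simp))
  obtain ⟨C₂, h₂⟩ := htr (quatJ (a : k) (b : k)) (hstd (Submodule.subset_span (by simp)))
  -- The sign compensates `(ij)² = -ab`.
  obtain ⟨C₃, h₃⟩ := htr (-(quatI (a : k) (b : k) * quatJ (a : k) (b : k)))
    (neg_mem (hstd (Submodule.subset_span (by simp))))
  obtain ⟨t₂, ht₂⟩ := htr (quatHalf a b x₀ x₁) (Submodule.subset_span (by simp))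
  obtain ⟨t₃, ht₃⟩ := htr (quatI (a : k) (b : k) * quatHalf a b x₀ x₁)
    (Submodule.subset_span (by simp))
  obtain ⟨N, hN⟩ := (QuaternionAlgebra.exists_trace_norm_of_isIntegral (hint x hx)).2
  replace h₀ : (C₀ : k) = 2 * x.re := by rw [h₀]; simp
  replace h₁ : (C₁ : k) = 2 * a * x.imI := by rw [h₁]; simp [quatI]; ring
  replace h₂ : (C₂ : k) = 2 * b * x.imJ := by rw [h₂]; simp [quatJ]; ring
  replace h₃ : (C₃ : k) = 2 * a * b * x.imK := by rw [h₃]; simp [quatI, quatJ]; ring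
  replace ht₂ : (t₂ : k) = x₀ * x.re + a * x₁ * x.imI + b * x.imJ := by
    rw [ht₂]; simp [quatHalf, quatI, quatJ, Algebra.smul_def]; ring
  replace ht₃ : (t₃ : k) = a * x₁ * x.re + a * x₀ * x.imI - a * b * x.imK := by
    rw [ht₃]; simp [quatHalf, quatI, quatJ, Algebra.smul_def]; ring
  have hN' : 4 * a * b * N = a * b * C₀ ^ 2 - b * C₁ ^ 2 - a * C₂ ^ 2 + C₃ ^ 2 := by
    apply FaithfulSMul.algebraMap_injective (𝓞 k) k
    simp only [map_mul, map_add, map_sub, map_pow, map_ofNat, hN, h₀, h₁, h₂, h₃]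
    ring
  let I : Ideal (𝓞 k) :=
    (quatHalfModule a b x₀ x₁).comap (LinearMap.toSpanSingleton (𝓞 k) ℍ[k, (a : k), (b : k)] x)
  have hI : ∀ r : 𝓞 k, r ∈ I ↔ r • x ∈ quatHalfModule a b x₀ x₁ := fun r => by simp [I]
  have habI : a * b ∈ I := (hI _).2 (smul_mem_quatHalfModule_of_trace hn h₀ h₁ ht₂ ht₃)
  suffices h : I = ⊤ by
    have := (hI 1).1 (h ▸ Submodule.mem_top)
    rwa [one_smul] at this
  by_contra hne
  obtain ⟨p, hp, hIp⟩ := I.exists_le_maximal hne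
  let v : HeightOneSpectrum (𝓞 k) :=
    ⟨p, hp.isPrime, fun h => mul_ne_zero ha hb (by simpa [h] using hIp habI)⟩
  have hab : a * b ∈ v.asIdeal := hIp habI
  obtain ⟨hramv, hsqf, h2⟩ := hram v hab
  obtain ⟨hi, hj, -⟩ := quat_relations (a : k) (b : k)
  have hij := quatI_mul_quatJ_ne (a : k) (b : k)
  have hnot : ¬ (a ∈ v.asIdeal ∧ b ∈ v.asIdeal) := by
    rintro ⟨hav, hbv⟩
    obtain ⟨u, w, huw⟩ := hcop
    refine v.isPrime.ne_top ((Ideal.eq_top_iff_one _).2 ?_)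
    rw [← huw]
    exact add_mem (Ideal.mul_mem_left _ _ hav) (Ideal.mul_mem_left _ _ hbv)
  have key : ∃ r ∉ v.asIdeal, r • x ∈ standardOrder (a : k) (b : k) := by
    rcases v.isPrime.mem_or_mem hab with hav | hbv
    · have hbv : b ∉ v.asIdeal := fun h => hnot ⟨hav, h⟩
      obtain ⟨r, hr, m₀, m₁, m₂, m₃, e₀, e₁, e₂, e₃⟩ := exists_denominator_notMem v h2 hav
        (fun h => hsqf (Ideal.mul_mem_right _ _ h)) hbv
        (sq_sub_notMem_of_isRamifiedAt hramv hj hij.symm hbv h2) hN'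
      exact ⟨r, hr, smul_mem_standardOrder_of_mul_eq ha hb h₀ h₁ h₂ h₃ e₀ e₁ e₂ e₃⟩
    · have hav : a ∉ v.asIdeal := fun h => hnot ⟨h, hbv⟩
      -- The norm equation is symmetric under exchanging `a, C₁` with `b, C₂`.
      obtain ⟨r, hr, m₀, m₂, m₁, m₃, e₀, e₂, e₁, e₃⟩ := exists_denominator_notMem v h2 hbv
        (fun h => hsqf (Ideal.mul_mem_left _ _ h)) hav
        (sq_sub_notMem_of_isRamifiedAt hramv hi hij hav h2)
        (C₀ := C₀) (C₁ := C₂) (C₂ := C₁) (C₃ := C₃) (n := N) (by linear_combination hN')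
      exact ⟨r, hr, smul_mem_standardOrder_of_mul_eq (m₃ := m₃) ha hb h₀ h₁ h₂ h₃ e₀ e₁ e₂
        (by linear_combination e₃)⟩
  obtain ⟨r, hr, hrx⟩ := key
  exact hr (hIp ((hI r).2 (hstd hrx)))

end Maximality

/-! ### Congruences modulo 4 and conclusion -/

/-- If `c` is a square modulo `4` and `v² ∤ c`, then `v` does not divide both `2` and `c`. -/
theorem Ideal.two_notMem_of_four_dvd {R : Type*} [CommRing R] {p : Ideal R} [hp : p.IsPrime]
    {c d : R} (h : 4 ∣ d ^ 2 - c) (hc : c ∈ p) (hc2 : c ∉ p ^ 2) : (2 : R) ∉ p := by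
  intro h2
  obtain ⟨e, he⟩ := h
  have h4 : (4 : R) * e ∈ p ^ 2 := by
    refine Ideal.mul_mem_right _ _ ?_
    convert Ideal.pow_mem_pow h2 2 using 1; norm_num
  have hd : d ∈ p := by
    refine hp.mem_of_pow_mem 2 ?_
    rw [show d ^ 2 = 4 * e + c by rw [← he]; ring]
    exact add_mem (Ideal.pow_le_self two_ne_zero h4) hc
  refine hc2 ?_
  rw [show c = d ^ 2 - 4 * e by rw [← he]; ring]
  exact sub_mem (Ideal.pow_mem_pow hd 2) h4

theorem mainTheorem5 (k : Type*) [Field k] [NumberField k] (a b : 𝓞 k)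
    (ha : a ≠ 0) (hb : b ≠ 0) (hcop : IsCoprime a b)
    (hcong : ((∃ a' : 𝓞 k, 4 ∣ a' ^ 2 - a) ∧ (∃ b' : 𝓞 k, 4 ∣ b' ^ 2 - b)) ∨
      (b = -1 ∧ ∃ a' : 𝓞 k, 4 ∣ a' ^ 2 - a))
    (hdisc : quatDiscriminant k ℍ[k, (a : k), (b : k)] = Ideal.span {a * b}) :
    ∃ (x₀ x₁ : 𝓞 k) (β : ℍ[k, (a : k), (b : k)]) (O : Subalgebra (𝓞 k) ℍ[k, (a : k), (b : k)]),
      β = (1 / 2 : k) • (x₀ • 1 + x₁ • quatI (a : k) (b : k) + quatJ (a : k) (b : k)) ∧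
      (2 : k) • β ∈ standardOrder (a : k) (b : k) ∧
      Subalgebra.toSubmodule O =
        Submodule.span (𝓞 k) {1, quatI (a : k) (b : k), β, quatI (a : k) (b : k) * β} ∧
      LinearIndependent (𝓞 k) ![1, quatI (a : k) (b : k), β, quatI (a : k) (b : k) * β] ∧
      standardOrder (a : k) (b : k) ≤ Subalgebra.toSubmodule O ∧
      IsMaximalROrder O := by
  have hram := HeightOneSpectrum.of_mem_finprod_asIdeal hdisc
  have hodd_a : ∀ v : HeightOneSpectrum (𝓞 k), a ∈ v.asIdeal → (2 : 𝓞 k) ∉ v.asIdeal := by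
    intro v hav
    obtain ⟨a', ha'⟩ : ∃ a' : 𝓞 k, 4 ∣ a' ^ 2 - a := hcong.elim (·.1) (·.2)
    exact Ideal.two_notMem_of_four_dvd ha' hav fun h =>
      (hram v (Ideal.mul_mem_right _ _ hav)).2 (Ideal.mul_mem_right _ _ h)
  have hodd : ∀ v : HeightOneSpectrum (𝓞 k), a * b ∈ v.asIdeal → (2 : 𝓞 k) ∉ v.asIdeal := by
    intro v hv
    rcases v.isPrime.mem_or_mem hv with hav | hbv
    · exact hodd_a v hav
    · rcases hcong with ⟨-, b', hb'⟩ | ⟨rfl, -⟩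
      · exact Ideal.two_notMem_of_four_dvd hb' hbv fun h => (hram v hv).2 (Ideal.mul_mem_left _ _ h)
      · exact absurd ((Ideal.eq_top_iff_one _).2 (by simpa using hbv)) v.isPrime.ne_top
  have hx : ∃ x₀ x₁ n : 𝓞 k, x₀ ^ 2 - a * x₁ ^ 2 - b = 4 * n := by
    rcases hcong with ⟨-, b', n, hn⟩ | ⟨rfl, a', n, hn⟩
    · exact ⟨b', 0, n, by linear_combination hn⟩
    -- A prime containing `a'` and `2` would contain `a = a'² - 4n`, against `hodd_a`.
    · have hcop2 : IsCoprime a' 2 := by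
        rw [← Ideal.isCoprime_span_singleton_iff, Ideal.isCoprime_iff_sup_eq]
        by_contra hne
        obtain ⟨p, hp, hle⟩ := Ideal.exists_le_maximal _ hne
        have ha'p : a' ∈ p := hle (Ideal.mem_sup_left (Ideal.mem_span_singleton_self _))
        have h2p : (2 : 𝓞 k) ∈ p := hle (Ideal.mem_sup_right (Ideal.mem_span_singleton_self _))
        refine hodd_a ⟨p, hp.isPrime, fun h => ?_⟩ ?_ h2p
        · rw [h, Ideal.mem_bot] at h2p
          exact two_ne_zero h2p
        · rw [show a = a' * a' - 2 * (2 * n) by linear_combination -hn]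
          exact sub_mem (p.mul_mem_left _ ha'p) (p.mul_mem_right _ h2p)
      obtain ⟨x₁, y, hxy⟩ := hcop2
      -- Modulo 4 the form `x₀² - a x₁²` factors as `(x₀ + a'x₁)(x₀ - a'x₁)`; the factors become `1`
      -- and `1 - 2a'x₁ = -1 + 4y`.
      exact ⟨1 - a' * x₁, x₁, y + n * x₁ ^ 2, by linear_combination x₁ ^ 2 * hn - 2 * hxy⟩
  obtain ⟨x₀, x₁, n, hn⟩ := hx
  exact ⟨x₀, x₁, quatHalf a b x₀ x₁, quatHalfOrder a b x₀ x₁ n hn, rfl,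
    two_smul_quatHalf_mem_standardOrder a b x₀ x₁, Submodule.toSubalgebra_toSubmodule _ _ _,
    linearIndependent_quatHalf a b x₀ x₁,
    standardOrder_le_quatHalfModule a b x₀ x₁, isMaximalROrder_quatHalfOrder ha hb hcop hn
      fun v hv => ⟨(hram v hv).1, (hram v hv).2, hodd v hv⟩⟩
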